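/- Let $n\ge 0$ be an integer and let $H\in M_n(\mathbb{C})$ be self-adjoint. For every (Hermitian) positive definite matrix $Y\in M_n(\mathbb{C})$ the trace $\mathrm{Tr}[\exp(H+\log Y)]$ is a real number, and the function $$Y\mapsto \mathrm{Tr}[\exp(H+\log Y)]$$ is concave on the convex set $M_n^{++}(\mathbb{C})$ of positive definite matrices in $M_n(\mathbb{C})$: for all $Y_1,Y_2\in M_n^{++}(\mathbb{C})$ and all $t\in[0,1]$, $$\mathrm{Tr}\big[\exp\big(H+\log(tY_1+(1-t)Y_2)\big)\big]\ \ge\ t\,\mathrm{Tr}[\exp(H+\log Y_1)]+(1-t)\,\mathrm{Tr}[\exp(H+\log Y_2)].$$ Here $\log Y$ is the self-adjoint logarithm given by the functional calculus and $\exp$ is the matrix exponential. -/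

import Mathlib

open scoped ComplexOrder Matrix.Norms.L2Operator

namespace Matrix

variable {m : Type*} [Fintype m] [DecidableEq m]

/-! For positive definite `Y`, `Tr exp (H + log Y)` is the maximum over positive definite `X` of `Tr
X H - D(X, Y) + Tr Y`, with `D` the relative entropy `relEntropy`. This is Klein's inequality `D(X,
exp (H + log Y)) ≥ 0`, with equality at `X = exp (H + log Y)`. Partial maximization of a jointly
concave function is concave, so joint convexity of `D` suffices.

For that, `D` is the integral over `s` in `[0, 1]` of `(1 - s) Q_s`, where `Q_s(X, Y) = ⟨X - Y, (s
L_X + (1 - s) R_Y)⁻¹ (X - Y)⟩` is `quadDivergence`. Completing the square makes `Q_s` a supremum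
over `W` of functions linear in `(X, Y)`, hence jointly convex. -/

/-- The matrix of inner products between the eigenvector bases of two Hermitian matrices. -/
noncomputable def eigenOverlap {X Y : Matrix m m ℂ} (hX : X.IsHermitian) (hY : Y.IsHermitian) :
    Matrix m m ℂ :=
  (hX.eigenvectorUnitary : Matrix m m ℂ)ᴴ * (hY.eigenvectorUnitary : Matrix m m ℂ)

/-! ### Traces in eigenbases -/

theorem IsHermitian.cfc_eq_mul_diagonal_mul {X : Matrix m m ℂ} (hX : X.IsHermitian) (f : ℝ → ℝ) :
    cfc f X = (hX.eigenvectorUnitary : Matrix m m ℂ) *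
      diagonal (fun i => ((f (hX.eigenvalues i) : ℝ) : ℂ)) *
      (hX.eigenvectorUnitary : Matrix m m ℂ)ᴴ := by
  rw [hX.cfc_eq, IsHermitian.cfc, Unitary.conjStarAlgAut_apply]
  rfl

theorem IsHermitian.eq_mul_diagonal_mul {X : Matrix m m ℂ} (hX : X.IsHermitian) :
    X = (hX.eigenvectorUnitary : Matrix m m ℂ) *
      diagonal (fun i => ((hX.eigenvalues i : ℝ) : ℂ)) *
      (hX.eigenvectorUnitary : Matrix m m ℂ)ᴴ := by
  rw [← hX.cfc_eq_mul_diagonal_mul fun x => x]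
  exact (cfc_id' ℝ X hX.isSelfAdjoint).symm

theorem IsHermitian.conjTranspose_eigenvectorUnitary_mul {X : Matrix m m ℂ} (hX : X.IsHermitian) :
    (hX.eigenvectorUnitary : Matrix m m ℂ)ᴴ * (hX.eigenvectorUnitary : Matrix m m ℂ) = 1 :=
  Unitary.coe_star_mul_self hX.eigenvectorUnitary

theorem IsHermitian.eigenvectorUnitary_mul_conjTranspose {X : Matrix m m ℂ} (hX : X.IsHermitian) :
    (hX.eigenvectorUnitary : Matrix m m ℂ) * (hX.eigenvectorUnitary : Matrix m m ℂ)ᴴ = 1 :=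
  Unitary.coe_mul_star_self hX.eigenvectorUnitary

theorem trace_diagonal_mul_mul_diagonal_mul_conjTranspose (a b : m → ℝ) (K : Matrix m m ℂ) :
    (diagonal (fun i => (a i : ℂ)) * K * diagonal (fun i => (b i : ℂ)) * Kᴴ).trace =
      ((∑ i, ∑ j, ‖K i j‖ ^ 2 * (a i * b j) : ℝ) : ℂ) := by
  push_cast
  refine Finset.sum_congr rfl fun i _ => ?_
  rw [diag_apply, mul_apply]
  refine Finset.sum_congr rfl fun j _ => ?_
  rw [mul_diagonal, diagonal_mul, conjTranspose_apply, Complex.star_def, ← Complex.mul_conj']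
  ring

theorem trace_cfc_mul_cfc {X Y : Matrix m m ℂ} (hX : X.IsHermitian) (hY : Y.IsHermitian)
    (f g : ℝ → ℝ) :
    (cfc f X * cfc g Y).trace = ((∑ i, ∑ j, ‖eigenOverlap hX hY i j‖ ^ 2 *
      (f (hX.eigenvalues i) * g (hY.eigenvalues j)) : ℝ) : ℂ) := by
  rw [← trace_diagonal_mul_mul_diagonal_mul_conjTranspose, hX.cfc_eq_mul_diagonal_mul f,
    hY.cfc_eq_mul_diagonal_mul g, Matrix.mul_assoc, Matrix.mul_assoc, trace_mul_comm, eigenOverlap,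
    conjTranspose_mul, conjTranspose_conjTranspose]
  simp only [Matrix.mul_assoc]

/-! ### Variational formula and convexity for the quadratic divergence -/

/-- For `0 < a`, the quadratic form `a * |k|²` dominates its tangent. -/
theorem two_mul_re_sub_le (k p : ℂ) {a : ℝ} (d : ℝ) (ha : 0 < a) :
    2 * (star k * (d * p)).re - a * ‖k‖ ^ 2 ≤ ‖p‖ ^ 2 * (d ^ 2 / a) := by
  rw [← mul_div_assoc, le_div_iff₀ ha, ← Complex.normSq_eq_norm_sq, ← Complex.normSq_eq_norm_sq,
    Complex.normSq_apply, Complex.normSq_apply]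
  simp only [Complex.star_def, Complex.mul_re, Complex.conj_re, Complex.ofReal_re,
    Complex.ofReal_im, Complex.mul_im, Complex.conj_im]
  nlinarith [sq_nonneg (a * k.re - d * p.re), sq_nonneg (a * k.im - d * p.im)]

theorem two_mul_re_sub_eq (p : ℂ) {a : ℝ} (d : ℝ) (ha : 0 < a) :
    2 * (star ((d / a : ℝ) * p : ℂ) * (d * p)).re - a * ‖((d / a : ℝ) * p : ℂ)‖ ^ 2 =
      ‖p‖ ^ 2 * (d ^ 2 / a) := by
  rw [← Complex.normSq_eq_norm_sq, ← Complex.normSq_eq_norm_sq, Complex.normSq_apply,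
    Complex.normSq_apply]
  simp only [Complex.star_def, Complex.mul_re, Complex.conj_re, Complex.ofReal_re,
    Complex.ofReal_im, Complex.mul_im, Complex.conj_im]
  field_simp
  ring

/-- The affine minorants whose supremum over `W` is `quadDivergence s`. -/
noncomputable def quadMinorant (s : ℝ) (X Y W : Matrix m m ℂ) : ℝ :=
  2 * (Wᴴ * (X - Y)).trace.re - s * (Wᴴ * X * W).trace.re - (1 - s) * (W * Y * Wᴴ).trace.re

/-- The quadratic form of the inverse of `s • L_X + (1 - s) • R_Y` at `X - Y`, where `L_X` and `R_Y`
are left multiplication by `X` and right multiplication by `Y`, in terms of eigenvalues. -/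
noncomputable def quadDivergence (s : ℝ) {X Y : Matrix m m ℂ} (hX : X.IsHermitian)
    (hY : Y.IsHermitian) : ℝ :=
  ∑ i, ∑ j, ‖eigenOverlap hX hY i j‖ ^ 2 * ((hX.eigenvalues i - hY.eigenvalues j) ^ 2 /
    (s * hX.eigenvalues i + (1 - s) * hY.eigenvalues j))

theorem quadMinorant_linear {ι : Type*} [Fintype ι] (s : ℝ) (X₁ Y₁ X₂ Y₂ W : Matrix ι ι ℂ) (a b : ℝ) :
    quadMinorant s (a • X₁ + b • X₂) (a • Y₁ + b • Y₂) W =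
      a * quadMinorant s X₁ Y₁ W + b * quadMinorant s X₂ Y₂ W := by
  simp only [quadMinorant, Matrix.mul_sub, Matrix.mul_add, Matrix.add_mul, Matrix.mul_smul,
    Matrix.smul_mul, trace_add, trace_sub, trace_smul, Complex.add_re, Complex.sub_re,
    Complex.smul_re, smul_eq_mul]
  ring

/-- In the two eigenbases `L_X` and `R_Y` act diagonally on the entries of `K`, so the maximization
over `W` decouples into scalar ones. -/
theorem quadMinorant_eq_sum (s : ℝ) {X Y : Matrix m m ℂ} (hX : X.IsHermitian)
    (hY : Y.IsHermitian) (K : Matrix m m ℂ) :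
    quadMinorant s X Y ((hX.eigenvectorUnitary : Matrix m m ℂ) * K *
        (hY.eigenvectorUnitary : Matrix m m ℂ)ᴴ) =
      ∑ i, ∑ j, (2 * (star (K i j) * ((hX.eigenvalues i - hY.eigenvalues j : ℝ) *
        eigenOverlap hX hY i j)).re -
        (s * hX.eigenvalues i + (1 - s) * hY.eigenvalues j) * ‖K i j‖ ^ 2) := by
  set U := (hX.eigenvectorUnitary : Matrix m m ℂ) with hU
  set V := (hY.eigenvectorUnitary : Matrix m m ℂ) with hV
  set x := hX.eigenvalues
  set y := hY.eigenvalues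
  have hUU : Uᴴ * U = 1 := hX.conjTranspose_eigenvectorUnitary_mul
  have hVV : Vᴴ * V = 1 := hY.conjTranspose_eigenvectorUnitary_mul
  have cancelU : ∀ Z : Matrix m m ℂ, Uᴴ * (U * Z) = Z := fun Z => by
    rw [← Matrix.mul_assoc, hUU, Matrix.one_mul]
  have cancelV : ∀ Z : Matrix m m ℂ, Vᴴ * (V * Z) = Z := fun Z => by
    rw [← Matrix.mul_assoc, hVV, Matrix.one_mul]
  have eX : X = U * (diagonal (fun i => (x i : ℂ)) * Uᴴ) := by
    rw [← Matrix.mul_assoc]; exact hX.eq_mul_diagonal_mul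
  have eY : Y = V * (diagonal (fun i => (y i : ℂ)) * Vᴴ) := by
    rw [← Matrix.mul_assoc]; exact hY.eq_mul_diagonal_mul
  have eW : (U * K * Vᴴ)ᴴ = V * (Kᴴ * Uᴴ) := by
    simp [conjTranspose_mul]
  have t1 : ((U * K * Vᴴ)ᴴ * (X - Y)).trace =
      ∑ i, ∑ j, star (K i j) * ((x i - y j : ℝ) * eigenOverlap hX hY i j) := by
    have h : ((U * K * Vᴴ)ᴴ * (X - Y)).trace =
        (Kᴴ * (diagonal (fun i => (x i : ℂ)) * eigenOverlap hX hY -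
          eigenOverlap hX hY * diagonal (fun i => (y i : ℂ)))).trace := by
      rw [eW, Matrix.mul_assoc, trace_mul_comm, eigenOverlap, ← hU, ← hV, eX, eY]
      simp only [Matrix.mul_assoc, Matrix.mul_sub, Matrix.sub_mul, cancelU, hVV, Matrix.mul_one]
    rw [h, trace, Finset.sum_comm]
    refine Finset.sum_congr rfl fun j _ => ?_
    rw [diag_apply, mul_apply]
    refine Finset.sum_congr rfl fun i _ => ?_
    rw [conjTranspose_apply, sub_apply, diagonal_mul, mul_diagonal]
    push_cast
    ring
  have t2 : ((U * K * Vᴴ)ᴴ * X * (U * K * Vᴴ)).trace =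
      ((∑ i, ∑ j, ‖K i j‖ ^ 2 * (x i * 1) : ℝ) : ℂ) := by
    rw [← trace_diagonal_mul_mul_diagonal_mul_conjTranspose x (fun _ => 1), trace_mul_comm, eW, eX]
    simp only [Matrix.mul_assoc, cancelU, cancelV, Complex.ofReal_one, diagonal_one,
      Matrix.one_mul]
    rw [trace_mul_comm]
    simp only [Matrix.mul_assoc, hUU, Matrix.mul_one]
    rw [← Matrix.mul_assoc, trace_mul_comm]
  have t3 : ((U * K * Vᴴ) * Y * (U * K * Vᴴ)ᴴ).trace =
      ((∑ i, ∑ j, ‖K i j‖ ^ 2 * (1 * y j) : ℝ) : ℂ) := by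
    rw [← trace_diagonal_mul_mul_diagonal_mul_conjTranspose (fun _ => 1) y, eW, Matrix.mul_assoc,
      Matrix.mul_assoc, Matrix.mul_assoc, trace_mul_comm, eY]
    simp only [Matrix.mul_assoc, cancelV, Complex.ofReal_one, diagonal_one, Matrix.one_mul]
    rw [hUU, Matrix.mul_one]
  rw [quadMinorant, t1, t2, t3, Complex.ofReal_re, Complex.ofReal_re]
  simp only [Complex.re_sum, Finset.mul_sum, ← Finset.sum_sub_distrib]
  refine Finset.sum_congr rfl fun i _ => Finset.sum_congr rfl fun j _ => ?_
  ring

theorem segment_pos {x y s : ℝ} (hx : 0 < x) (hy : 0 < y) (hs : s ∈ Set.Icc (0 : ℝ) 1) :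
    0 < s * x + (1 - s) * y :=
  convex_Ioi (0 : ℝ) hx hy hs.1 (sub_nonneg.2 hs.2) (by ring)

theorem quadMinorant_le_quadDivergence {s : ℝ} (hs : s ∈ Set.Icc (0 : ℝ) 1) {X Y : Matrix m m ℂ}
    (hX : X.PosDef) (hY : Y.PosDef) (W : Matrix m m ℂ) :
    quadMinorant s X Y W ≤ quadDivergence s hX.isHermitian hY.isHermitian := by
  set U := (hX.isHermitian.eigenvectorUnitary : Matrix m m ℂ) with hU
  set V := (hY.isHermitian.eigenvectorUnitary : Matrix m m ℂ) with hV
  have hW : W = U * (Uᴴ * W * V) * Vᴴ := by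
    have hUU : U * Uᴴ = 1 := hX.isHermitian.eigenvectorUnitary_mul_conjTranspose
    have hVV : V * Vᴴ = 1 := hY.isHermitian.eigenvectorUnitary_mul_conjTranspose
    simp only [Matrix.mul_assoc, hVV, Matrix.mul_one]
    rw [← Matrix.mul_assoc, hUU, Matrix.one_mul]
  rw [hW, quadMinorant_eq_sum s hX.isHermitian hY.isHermitian]
  exact Finset.sum_le_sum fun i _ => Finset.sum_le_sum fun j _ =>
    two_mul_re_sub_le _ _ _ (segment_pos (hX.eigenvalues_pos i) (hY.eigenvalues_pos j) hs)

theorem exists_quadMinorant_eq_quadDivergence {s : ℝ} (hs : s ∈ Set.Icc (0 : ℝ) 1)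
    {X Y : Matrix m m ℂ} (hX : X.PosDef) (hY : Y.PosDef) :
    ∃ W, quadMinorant s X Y W = quadDivergence s hX.isHermitian hY.isHermitian := by
  -- The maximizer solves `s X W + (1 - s) W Y = X - Y`, entrywise in the eigenbases.
  refine ⟨_, (quadMinorant_eq_sum s hX.isHermitian hY.isHermitian (of fun i j =>
    (((hX.isHermitian.eigenvalues i - hY.isHermitian.eigenvalues j) /
      (s * hX.isHermitian.eigenvalues i + (1 - s) * hY.isHermitian.eigenvalues j) : ℝ) : ℂ) *
      eigenOverlap hX.isHermitian hY.isHermitian i j)).trans ?_⟩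
  exact Finset.sum_congr rfl fun i _ => Finset.sum_congr rfl fun j _ =>
    two_mul_re_sub_eq _ _ (segment_pos (hX.eigenvalues_pos i) (hY.eigenvalues_pos j) hs)

theorem quadDivergence_nonneg {s : ℝ} (hs : s ∈ Set.Icc (0 : ℝ) 1) {X Y : Matrix m m ℂ}
    (hX : X.PosDef) (hY : Y.PosDef) : 0 ≤ quadDivergence s hX.isHermitian hY.isHermitian :=
  Finset.sum_nonneg fun i _ => Finset.sum_nonneg fun j _ => mul_nonneg (sq_nonneg _) <|
    div_nonneg (sq_nonneg _) (segment_pos (hX.eigenvalues_pos i) (hY.eigenvalues_pos j) hs).le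

theorem quadDivergence_convex {s : ℝ} (hs : s ∈ Set.Icc (0 : ℝ) 1)
    {X₁ Y₁ X₂ Y₂ : Matrix m m ℂ} (hX₁ : X₁.PosDef) (hY₁ : Y₁.PosDef) (hX₂ : X₂.PosDef)
    (hY₂ : Y₂.PosDef) {a b : ℝ} (ha : 0 ≤ a) (hb : 0 ≤ b) (hX : (a • X₁ + b • X₂).PosDef)
    (hY : (a • Y₁ + b • Y₂).PosDef) :
    quadDivergence s hX.isHermitian hY.isHermitian ≤
      a * quadDivergence s hX₁.isHermitian hY₁.isHermitian +
        b * quadDivergence s hX₂.isHermitian hY₂.isHermitian := by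
  -- This `W` is optimal at the combination and merely admissible at the two endpoints.
  obtain ⟨W, hW⟩ := exists_quadMinorant_eq_quadDivergence hs hX hY
  rw [← hW, quadMinorant_linear]
  gcongr
  · exact quadMinorant_le_quadDivergence hs hX₁ hY₁ W
  · exact quadMinorant_le_quadDivergence hs hX₂ hY₂ W

/-! ### Relative entropy as an integral -/

theorem continuousOn_segment_div {x y : ℝ} (hx : 0 < x) (hy : 0 < y) (c : ℝ) :
    ContinuousOn (fun s : ℝ => (1 - s) * (c / (s * x + (1 - s) * y))) (Set.Icc 0 1) := by
  refine ContinuousOn.mul (by fun_prop) (ContinuousOn.div (by fun_prop) (by fun_prop) ?_)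
  exact fun s hs => (segment_pos hx hy hs).ne'

/-- Taylor's formula at `y` with integral remainder for `t log t`, whose second derivative is `1 /
t`. -/
theorem integral_segment_div {x y : ℝ} (hx : 0 < x) (hy : 0 < y) :
    ∫ s in (0 : ℝ)..1, (1 - s) * ((x - y) ^ 2 / (s * x + (1 - s) * y)) =
      x * Real.log x - x * Real.log y - x + y := by
  have key : ∀ s ∈ Set.uIcc (0 : ℝ) 1,
      HasDerivAt (fun s : ℝ => x * Real.log (s * x + (1 - s) * y) - (x - y) * s)
        ((1 - s) * ((x - y) ^ 2 / (s * x + (1 - s) * y))) s := by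
    intro s hs
    rw [Set.uIcc_of_le zero_le_one] at hs
    have hpos := (segment_pos hx hy hs).ne'
    have h1 : HasDerivAt (fun s : ℝ => s * x + (1 - s) * y) (1 * x + (0 - 1) * y) s :=
      ((hasDerivAt_id s).mul_const x).add (((hasDerivAt_const s 1).sub (hasDerivAt_id s)).mul_const y)
    have h2 := ((h1.log hpos).const_mul x).sub ((hasDerivAt_id s).const_mul (x - y))
    refine h2.congr_deriv ?_
    rw [mul_one, mul_div_assoc', mul_div_assoc', div_sub' hpos]
    congr 1
    ring
  rw [intervalIntegral.integral_eq_sub_of_hasDerivAt key]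
  · simp
    ring
  · refine ContinuousOn.intervalIntegrable ?_
    rw [Set.uIcc_of_le zero_le_one]
    exact continuousOn_segment_div hx hy _

/-- The Umegaki relative entropy of two (not necessarily normalized) matrices. -/
noncomputable def relEntropy (X Y : Matrix m m ℂ) : ℝ :=
  (X * CFC.log X - X * CFC.log Y - X + Y).trace.re

theorem relEntropy_eq_sum {X Y : Matrix m m ℂ} (hX : X.IsHermitian) (hY : Y.IsHermitian) :
    relEntropy X Y = ∑ i, ∑ j, ‖eigenOverlap hX hY i j‖ ^ 2 *
      (hX.eigenvalues i * Real.log (hX.eigenvalues i) -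
        hX.eigenvalues i * Real.log (hY.eigenvalues j) - hX.eigenvalues i + hY.eigenvalues j) := by
  have sX : IsSelfAdjoint X := hX.isSelfAdjoint
  have sY : IsSelfAdjoint Y := hY.isSelfAdjoint
  have cont : ∀ f : ℝ → ℝ, ContinuousOn f (spectrum ℝ X) := fun f =>
    (hX.spectrum_real_eq_range_eigenvalues ▸ Set.finite_range _ : (spectrum ℝ X).Finite).continuousOn f
  -- Factors `cfc 1 = 1` put all four terms in the form required by `trace_cfc_mul_cfc`.
  have e1 : X * CFC.log X = cfc (fun x => x * Real.log x) X * cfc (fun _ => (1 : ℝ)) Y := by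
    rw [cfc_const_one ℝ Y, mul_one, cfc_mul (p := IsSelfAdjoint) (fun x : ℝ => x) Real.log X (cont _) (cont _),
      cfc_id' ℝ X sX, CFC.log]
  have e2 : X * CFC.log Y = cfc (fun x : ℝ => x) X * cfc Real.log Y := by
    rw [cfc_id' ℝ X sX, CFC.log]
  have e3 : X = cfc (fun x : ℝ => x) X * cfc (fun _ => (1 : ℝ)) Y := by
    rw [cfc_const_one ℝ Y, mul_one, cfc_id' ℝ X sX]
  have e4 : Y = cfc (fun _ => (1 : ℝ)) X * cfc (fun x : ℝ => x) Y := by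
    rw [cfc_const_one ℝ X, one_mul, cfc_id' ℝ Y sY]
  have t1 := congrArg trace e1
  have t2 := congrArg trace e2
  have t3 := congrArg trace e3
  have t4 := congrArg trace e4
  rw [trace_cfc_mul_cfc hX hY] at t1 t2 t3 t4
  rw [relEntropy, trace_add, trace_sub, trace_sub, t1, t2, t3, t4]
  simp only [Complex.add_re, Complex.sub_re, Complex.ofReal_re, ← Finset.sum_sub_distrib,
    ← Finset.sum_add_distrib]
  refine Finset.sum_congr rfl fun i _ => Finset.sum_congr rfl fun j _ => ?_
  ring

theorem intervalIntegrable_quadDivergence {X Y : Matrix m m ℂ} (hX : X.PosDef) (hY : Y.PosDef) :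
    IntervalIntegrable (fun s => (1 - s) * quadDivergence s hX.isHermitian hY.isHermitian)
      MeasureTheory.volume 0 1 := by
  refine ContinuousOn.intervalIntegrable ?_
  rw [Set.uIcc_of_le zero_le_one]
  simp only [quadDivergence, Finset.mul_sum, mul_left_comm (1 - _ : ℝ)]
  exact continuousOn_finsetSum _ fun i _ => continuousOn_finsetSum _ fun j _ =>
    (continuousOn_segment_div (hX.eigenvalues_pos i) (hY.eigenvalues_pos j) _).const_mul _

theorem relEntropy_eq_integral {X Y : Matrix m m ℂ} (hX : X.PosDef) (hY : Y.PosDef) :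
    relEntropy X Y =
      ∫ s in (0 : ℝ)..1, (1 - s) * quadDivergence s hX.isHermitian hY.isHermitian := by
  have hint : ∀ i j, IntervalIntegrable (fun s : ℝ =>
      ‖eigenOverlap hX.isHermitian hY.isHermitian i j‖ ^ 2 * ((1 - s) *
        ((hX.isHermitian.eigenvalues i - hY.isHermitian.eigenvalues j) ^ 2 /
        (s * hX.isHermitian.eigenvalues i + (1 - s) * hY.isHermitian.eigenvalues j))))
      MeasureTheory.volume 0 1 := fun i j => by
    refine ContinuousOn.intervalIntegrable ?_
    rw [Set.uIcc_of_le zero_le_one]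
    exact (continuousOn_segment_div (hX.eigenvalues_pos i) (hY.eigenvalues_pos j) _).const_mul _
  have hint' : ∀ i, IntervalIntegrable (fun s : ℝ => ∑ j,
      ‖eigenOverlap hX.isHermitian hY.isHermitian i j‖ ^ 2 * ((1 - s) *
        ((hX.isHermitian.eigenvalues i - hY.isHermitian.eigenvalues j) ^ 2 /
        (s * hX.isHermitian.eigenvalues i + (1 - s) * hY.isHermitian.eigenvalues j))))
      MeasureTheory.volume 0 1 := fun i => by
    simpa only [Finset.sum_fn] using IntervalIntegrable.sum Finset.univ fun j _ => hint i j
  rw [relEntropy_eq_sum hX.isHermitian hY.isHermitian]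
  simp only [quadDivergence, Finset.mul_sum, mul_left_comm (1 - _ : ℝ)]
  rw [intervalIntegral.integral_finsetSum fun i _ => hint' i]
  refine Finset.sum_congr rfl fun i _ => ?_
  rw [intervalIntegral.integral_finsetSum fun j _ => hint i j]
  refine Finset.sum_congr rfl fun j _ => ?_
  rw [intervalIntegral.integral_const_mul,
    integral_segment_div (hX.eigenvalues_pos i) (hY.eigenvalues_pos j)]

/-- **Klein's inequality** for the relative entropy. -/
theorem relEntropy_nonneg {X Y : Matrix m m ℂ} (hX : X.PosDef) (hY : Y.PosDef) :
    0 ≤ relEntropy X Y := by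
  rw [relEntropy_eq_integral hX hY]
  exact intervalIntegral.integral_nonneg zero_le_one fun s hs =>
    mul_nonneg (sub_nonneg.2 hs.2) (quadDivergence_nonneg hs hX hY)

theorem PosDef.convexCombo {ι : Type*} {X₁ X₂ : Matrix ι ι ℂ} (h₁ : X₁.PosDef) (h₂ : X₂.PosDef) {a b : ℝ}
    (ha : 0 ≤ a) (hb : 0 ≤ b) (hab : a + b = 1) : (a • X₁ + b • X₂).PosDef := by
  rcases ha.eq_or_lt with rfl | ha
  · obtain rfl : b = 1 := by linarith
    simpa using h₂
  · exact (h₁.smul ha).add_posSemidef (h₂.posSemidef.smul hb)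

/-- Joint convexity of the relative entropy. -/
theorem relEntropy_convex {X₁ Y₁ X₂ Y₂ : Matrix m m ℂ} (hX₁ : X₁.PosDef) (hY₁ : Y₁.PosDef)
    (hX₂ : X₂.PosDef) (hY₂ : Y₂.PosDef) {a b : ℝ} (ha : 0 ≤ a) (hb : 0 ≤ b) (hab : a + b = 1) :
    relEntropy (a • X₁ + b • X₂) (a • Y₁ + b • Y₂) ≤
      a * relEntropy X₁ Y₁ + b * relEntropy X₂ Y₂ := by
  have hX := hX₁.convexCombo hX₂ ha hb hab
  have hY := hY₁.convexCombo hY₂ ha hb hab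
  have i₁ := intervalIntegrable_quadDivergence hX₁ hY₁
  have i₂ := intervalIntegrable_quadDivergence hX₂ hY₂
  rw [relEntropy_eq_integral hX hY, relEntropy_eq_integral hX₁ hY₁,
    relEntropy_eq_integral hX₂ hY₂, ← intervalIntegral.integral_const_mul,
    ← intervalIntegral.integral_const_mul,
    ← intervalIntegral.integral_add (i₁.const_mul a) (i₂.const_mul b)]
  refine intervalIntegral.integral_mono_on zero_le_one (intervalIntegrable_quadDivergence hX hY)
    ((i₁.const_mul a).add (i₂.const_mul b)) fun s hs => ?_
  have h := mul_le_mul_of_nonneg_left (quadDivergence_convex hs hX₁ hY₁ hX₂ hY₂ ha hb hX hY)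
    (sub_nonneg.2 hs.2)
  linarith

/-! ### Gibbs variational principle -/

open scoped MatrixOrder in
theorem IsHermitian.posDef_exp {A : Matrix m m ℂ} (hA : A.IsHermitian) :
    (NormedSpace.exp A).PosDef :=
  isStrictlyPositive_iff_posDef.1 <|
    (Matrix.isUnit_exp A).isStrictlyPositive hA.isSelfAdjoint.exp_nonneg

theorem isHermitian_add_log {H : Matrix m m ℂ} (hH : H.IsHermitian) (Y : Matrix m m ℂ) :
    (H + CFC.log Y).IsHermitian :=
  hH.add (IsSelfAdjoint.log (a := Y))

/-- The Gibbs variational inequality for `Tr exp (H + log Y)`. -/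
theorem gibbs_le_trace_exp {H X Y : Matrix m m ℂ} (hH : H.IsHermitian) (hX : X.PosDef) :
    (X * H).trace.re - relEntropy X Y + Y.trace.re ≤
      (NormedSpace.exp (H + CFC.log Y)).trace.re := by
  have hA := isHermitian_add_log hH Y
  -- The gap between the two sides of the goal is exactly `D(X, exp (H + log Y))`.
  have h := relEntropy_nonneg hX hA.posDef_exp
  rw [relEntropy, CFC.log_exp _ hA.isSelfAdjoint] at h
  rw [relEntropy]
  simp only [Matrix.mul_add, trace_add, trace_sub, Complex.add_re, Complex.sub_re] at h ⊢
  linarith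

theorem gibbs_eq_trace_exp {H Y : Matrix m m ℂ} (hH : H.IsHermitian) :
    (NormedSpace.exp (H + CFC.log Y) * H).trace.re -
      relEntropy (NormedSpace.exp (H + CFC.log Y)) Y + Y.trace.re =
      (NormedSpace.exp (H + CFC.log Y)).trace.re := by
  rw [relEntropy, CFC.log_exp _ (isHermitian_add_log hH Y).isSelfAdjoint]
  simp only [Matrix.mul_add, trace_add, trace_sub, Complex.add_re, Complex.sub_re]
  ring

end Matrix

theorem theorem1 (n : ℕ) (H : Matrix (Fin n) (Fin n) ℂ) (hH : H.IsHermitian) :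
    (∀ Y : Matrix (Fin n) (Fin n) ℂ, Y.PosDef →
      (NormedSpace.exp (H + CFC.log Y)).trace.im = 0) ∧
    ConcaveOn ℝ {Y : Matrix (Fin n) (Fin n) ℂ | Y.PosDef}
      (fun Y => (NormedSpace.exp (H + CFC.log Y)).trace.re) := by
  refine ⟨fun Y _ => ?_, fun Y₁ h₁ Y₂ h₂ a b ha hb hab => h₁.convexCombo h₂ ha hb hab,
    fun Y₁ h₁ Y₂ h₂ a b ha hb hab => ?_⟩
  · have h := (Matrix.isHermitian_add_log hH Y).posDef_exp.isHermitian
    rw [← Complex.conj_eq_iff_im, ← Complex.star_def, ← Matrix.trace_conjTranspose, h.eq]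
  · have p₁ := (Matrix.isHermitian_add_log hH Y₁).posDef_exp
    have p₂ := (Matrix.isHermitian_add_log hH Y₂).posDef_exp
    -- The trial point is the same convex combination of the maximizers for `Y₁` and `Y₂`.
    have key := Matrix.gibbs_le_trace_exp (Y := a • Y₁ + b • Y₂) hH
      (p₁.convexCombo p₂ ha hb hab)
    have conv := Matrix.relEntropy_convex p₁ h₁ p₂ h₂ ha hb hab
    simp only [Matrix.add_mul, Matrix.smul_mul, Matrix.trace_add, Matrix.trace_smul,
      Complex.add_re, Complex.smul_re, smul_eq_mul] at key
    simp only [smul_eq_mul]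
    rw [← Matrix.gibbs_eq_trace_exp (Y := Y₁) hH, ← Matrix.gibbs_eq_trace_exp (Y := Y₂) hH]
    linarith
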